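/- Let $F$ be a (commutative) field with involution $r\mapsto r^*$, let $d,n\ge 0$, and let $\alpha_1,\dots,\alpha_d\in F$ satisfy $\alpha_i=\alpha_i^*\neq 0$. Let ${\sf L}(F^d_{\bar\alpha})$ be the set of all linear subspaces of $F^d$ with the constant $0$ (zero subspace), the sum $U_1+U_2$ and the involution $U^\perp=\{x\mid \forall u\in U:\ \sum_i x_i^*\alpha_iu_i=0\}$. Let $M\subseteq {\sf L}(F^d_{\bar\alpha})^n$ be defined by a quantifier free first order formula (without parameters) in the signature $+,0,{}^\perp$, and let $d_1,\dots,d_n\le d$. For $0\le k\le d$ let $I_k$ be the set of strictly increasing $k$-tuples in $\{1,\dots,d\}$. For $k>0$ and a $k$-dimensional subspace $U\subseteq F^d$ spanned by the columns of a $d\times d$-matrix $A$, let ${\sf P}_k(U)\subseteq F^{I_k}$ consist of the nonzero vectors in the (one-dimensional) span of the vectors $(\det A_{\bar i}^{\bar j})_{\bar i\in I_k}$, $\bar j\in I_k$, where $A_{\bar i}^{\bar j}$ is the submatrix with rows $\bar i$ and columns $\bar j$; put ${\sf P}_0(0)=\{0\}\subseteq F^{I_0}=F$. Let $\Gamma_k$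 be the union of the ${\sf P}_k(U)$ over all $k$-dimensional $U$ (the Grassmannian, in homogeneous coordinates). A basic formula is a finite conjunction of formulas $p=0$ and $q\neq0$ where $p,q$ are $*$-polynomials, i.e. $\mathbb{Z}[c_1,\dots,c_d]$-linear combinations of terms $\prod_s y_s^{k_s}(y_s^*)^{l_s}$, with $c_i$ interpreted as $\alpha_i$. A basic formula $\chi$ in variables $y_{k,\bar i}$ ($1\le k\le n$, $\bar i\in I_{d_k}$) is scalar invariant if for all $(r_1,\dots,r_n)\in\Gamma_{d_1}\times\dots\times\Gamma_{d_n}$ and all nonzero $\lambda_1,\dots,\lambda_n\in F$, $\chi(r_1,\dots,r_n)$ holds iff $\chi(\lambda_1r_1,\dots,\lambda_nr_n)$ holds. Then \[\Delta=\bigcup\{{\sf P}_{d_1}(u_1)\times\dots\times{\sf P}_{d_n}(u_n)\mid (u_1,\dots,u_n)\in M,\ \dim u_k=d_k \text{ for all } k\}\] is a subset of $\Gamma_{d_1}\times\dots\times\Gamma_{d_n}$, is closed under multiplying each component by a nonzero scalar (so that it may be considered a subset of the product of the projective Grassmannians), and is the union of finitely many pairwise disjoint sets, each of which is the set of all points of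 $F^{I_{d_1}}\times\dots\times F^{I_{d_n}}$ satisfying some scalar invariant basic formula. -/

import Mathlib

namespace PluckerQF

noncomputable section

/-! ## Bounded lattices with involution: the language and the lattice of subspaces -/

/-- Function symbols of the signature `+`, `0`, `⊥` of bounded lattices with involution. -/
inductive LatFunc : ℕ → Type
  | zero : LatFunc 0
  | perp : LatFunc 1
  | add : LatFunc 2

/-- The first order language of bounded lattices with involution: `+`, `0`, `⊥`, no relation
symbols besides equality. -/
def latLang : FirstOrder.Language.{0, 0} := ⟨LatFunc, fun _ => Empty⟩

variable {F : Type*} [Field F] [StarRing F] {d : ℕ}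

/-- The form `⟨x | y⟩ = ∑ xᵢ* αᵢ yᵢ` on `F ^ d` with form constants `α`. -/
def form (α : Fin d → F) (x y : Fin d → F) : F := ∑ i, star (x i) * α i * y i

/-- `U^⊥ = {x | ∀ u ∈ U, ⟨x | u⟩ = 0}`. -/
def perp (α : Fin d → F) (U : Submodule F (Fin d → F)) : Submodule F (Fin d → F) where
  carrier := {x | ∀ u ∈ U, form α x u = 0}
  add_mem' := by
    intro a b ha hb u hu
    have h : form α (a + b) u = form α a u + form α b u := by
      simp [form, add_mul, Finset.sum_add_distrib]
    rw [h, ha u hu, hb u hu, add_zero]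
  zero_mem' := by
    intro u _
    simp [form]
  smul_mem' := by
    intro c x hx u hu
    have h : form α (c • x) u = star c * form α x u := by
      simp [form, Finset.mul_sum, mul_assoc]
    rw [h, hx u hu, mul_zero]

/-- The set of all linear subspaces of `F ^ d` with form constants `α`. -/
def SubspaceLattice (_α : Fin d → F) : Type _ := Submodule F (Fin d → F)

/-- A member of the lattice as a subspace of `F ^ d`. -/
def SubspaceLattice.toSubmodule {α : Fin d → F} (u : SubspaceLattice α) :
    Submodule F (Fin d → F) := u

/-- A subspace of `F ^ d` as a member of the lattice. -/
def SubspaceLattice.of (α : Fin d → F) (U : Submodule F (Fin d → F)) : SubspaceLattice α := U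

/-- The subspaces as a structure for the language: `0` is the zero subspace, `+` the sum of
subspaces, and `⊥` the orthogonal with respect to the form. -/
instance (α : Fin d → F) : latLang.Structure (SubspaceLattice α) where
  funMap {_} f :=
    match f with
    | LatFunc.zero => fun _ => SubspaceLattice.of α ⊥
    | LatFunc.perp => fun u => SubspaceLattice.of α (perp α (u 0).toSubmodule)
    | LatFunc.add => fun u => SubspaceLattice.of α ((u 0).toSubmodule ⊔ (u 1).toSubmodule)
  RelMap {_} r := nomatch r

/-- `M` is definable (without parameters) by a quantifier free formula. -/
def IsQFDefinable (α : Fin d → F) {n : ℕ} (M : Set (Fin n → SubspaceLattice α)) : Prop :=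
  ∃ φ : latLang.Formula (Fin n), φ.IsQF ∧ M = {u | φ.Realize u}

/-! ## Plücker coordinates -/

/-- The index set `I_k` of all strictly increasing `k`-tuples in `{1, …, d}`. -/
abbrev Idx (d k : ℕ) : Type := Fin k ↪o Fin d

/-- The tuple of the `k × k` minors of `A` taken from the columns `j`. -/
def minors {F : Type*} [Field F] {d k : ℕ} (A : Matrix (Fin d) (Fin d) F) (j : Idx d k) :
    Idx d k → F :=
  fun i => (A.submatrix i j).det

/-- The subspace spanned by the columns of `A`. -/
def colSpan {F : Type*} [Field F] {d : ℕ} (A : Matrix (Fin d) (Fin d) F) :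
    Submodule F (Fin d → F) :=
  Submodule.span F (Set.range fun j i => A i j)

/-- The set of Plücker coordinates of a matrix `A`, to be used for `A` of rank `k`: all nonzero
vectors in the span of the tuples of minors. By convention the only coordinate tuple for `k = 0`
is `0`. -/
def matrixPlucker {F : Type*} [Field F] {d : ℕ} (k : ℕ) (A : Matrix (Fin d) (Fin d) F) :
    Set (Idx d k → F) :=
  if k = 0 then {0} else
    (Submodule.span F (Set.range fun j : Idx d k => minors A j) : Set (Idx d k → F)) \ {0}

/-- The set of Plücker coordinates of a subspace `U`, to be used for `U` of dimension `k`. -/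
def plucker {F : Type*} [Field F] {d : ℕ} (k : ℕ) (U : Submodule F (Fin d → F)) :
    Set (Idx d k → F) :=
  {r | ∃ A : Matrix (Fin d) (Fin d) F, colSpan A = U ∧ r ∈ matrixPlucker k A}

/-- The (affine cone without vertex over the) Grassmannian of `k`-dimensional subspaces
of `F ^ d`. -/
def grassmann (F : Type*) [Field F] (d k : ℕ) : Set (Idx d k → F) :=
  {r | ∃ A : Matrix (Fin d) (Fin d) F, A.rank = k ∧ r ∈ matrixPlucker k A}

/-- Tuples of coordinate vectors for the dimension vector `dims`. -/
abbrev Coords (F : Type*) (d : ℕ) {n : ℕ} (dims : Fin n → ℕ) : Type _ :=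
  (k : Fin n) → Idx d (dims k) → F

/-- The product of the Grassmannians for the dimension vector `dims`. -/
def grassmannProd (F : Type*) [Field F] (d : ℕ) {n : ℕ} (dims : Fin n → ℕ) :
    Set (Coords F d dims) :=
  {r | ∀ k, r k ∈ grassmann F d (dims k)}

/-- A set of coordinate tuples closed under scaling each component by a nonzero scalar. -/
def ScalarInvariant {F : Type*} [Field F] {d n : ℕ} {dims : Fin n → ℕ}
    (Δ : Set (Coords F d dims)) : Prop :=
  ∀ r ∈ Δ, ∀ c : Fin n → F, (∀ k, c k ≠ 0) → (fun k => c k • r k) ∈ Δ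

/-- All tuples of Plücker coordinates of the members `u` of `M` with `dim u_k = dims k`. -/
def pluckerSet {α : Fin d → F} {n : ℕ} (M : Set (Fin n → SubspaceLattice α))
    (dims : Fin n → ℕ) : Set (Coords F d dims) :=
  {r | ∃ u ∈ M, ∀ k,
    Module.finrank F (u k).toSubmodule = dims k ∧ r k ∈ plucker (dims k) (u k).toSubmodule}

/-! ## Basic formulas in the language of `*`-rings with constants -/

/-- Basic terms: `*`-polynomials in the variables `σ` with coefficients in `ℤ[c₁, …, c_d]`.
The variable `Sum.inl s` stands for `s` and `Sum.inr s` for `s*`. -/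
abbrev BasicTerm (d : ℕ) (σ : Type) : Type := MvPolynomial (σ ⊕ σ) (MvPolynomial (Fin d) ℤ)

/-- The value of a basic term at `x`, the constants `c` being interpreted as `α`. -/
def BasicTerm.value (α : Fin d → F) {σ : Type} (p : BasicTerm d σ) (x : σ → F) : F :=
  MvPolynomial.eval₂ (MvPolynomial.eval₂Hom (Int.castRingHom F) α)
    (Sum.elim x fun s => star (x s)) p

/-- Basic formulas: conjunctions of finitely many `p = 0` and finitely many `q ≠ 0` with basic
terms `p`, `q`. -/
structure BasicFormula (d : ℕ) (σ : Type) where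
  eqs : List (BasicTerm d σ)
  neqs : List (BasicTerm d σ)

/-- Validity of a basic formula in `F` at `x`, the constants `c` being interpreted as `α`. -/
def BasicFormula.Holds (α : Fin d → F) {σ : Type} (χ : BasicFormula d σ) (x : σ → F) : Prop :=
  (∀ p ∈ χ.eqs, BasicTerm.value α p x = 0) ∧ (∀ q ∈ χ.neqs, BasicTerm.value α q x ≠ 0)

/-- The variables `y_{k,i}`, one for each Plücker coordinate. -/
abbrev CoordVar (d : ℕ) {n : ℕ} (dims : Fin n → ℕ) : Type := (k : Fin n) × Idx d (dims k)

/-- The set of all coordinate tuples at which a basic formula holds. -/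
def BasicFormula.definedSet (α : Fin d → F) {n : ℕ} {dims : Fin n → ℕ}
    (χ : BasicFormula d (CoordVar d dims)) : Set (Coords F d dims) :=
  {r | χ.Holds α fun s => r s.1 s.2}

/-- A basic formula is scalar invariant if its validity at points of the product of the
Grassmannians does not change when the components are scaled by nonzero scalars. -/
def BasicFormula.IsScalarInvariant (α : Fin d → F) {n : ℕ} {dims : Fin n → ℕ}
    (χ : BasicFormula d (CoordVar d dims)) : Prop :=
  ∀ r ∈ grassmannProd F d dims, ∀ c : Fin n → F, (∀ k, c k ≠ 0) →
    (r ∈ χ.definedSet α ↔ (fun k => c k • r k) ∈ χ.definedSet α)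

end

end PluckerQF

open Matrix

namespace PluckerQF

/-! ### Factoring a matrix through an invertible submatrix. -/

section LinearAlgebra

variable {K : Type*} [Field K]

/-! Fix pivots `J`, one index tuple per component, and scale each coordinate vector to have entry 1
at its pivot. Then `u_k` is the column space of an explicit matrix whose entries are signed
coordinates, and a vector is a Plücker vector exactly when it equals the minors of that matrix
(`mem_plucker_iff`). So no Plücker relations are needed.

Subspaces that are column spaces of matrices of `*`-polynomials are stable under the lattice
operations: a sum juxtaposes columns, and an orthogonal is the kernel of a matrix of conjugates. A
kernel is again a column space by a division-free formula, once an invertible submatrix of maximal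
rank is known. Which submatrices qualify depends only on which of finitely many `*`-polynomials
vanish; the same holds for inclusion of column spaces. Hence the truth of a quantifier free formula
at the normalized point depends only on the zero pattern of a finite set of `*`-polynomials
(`Determined.qf_realize`).

Clearing denominators (`exists_cleared_term`) turns these into `*`-polynomials in the original
coordinates whose vanishing is unaffected by scaling. Collecting them over the finitely many `J`,
the zero patterns partition the coordinate space into finitely many sets given by basic formulas,
and `Δ` is a union of such sets (`exists_disjoint_basicFormulas`). -/

theorem exists_fin_basis_of_range {V ι : Type*} [AddCommGroup V] [Module K V] [Finite ι]
    (v : ι → V) {k : ℕ} (hk : Module.finrank K (Submodule.span K (Set.range v)) = k) :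
    ∃ g : Fin k → ι, LinearIndependent K (v ∘ g) ∧
      Submodule.span K (Set.range (v ∘ g)) = Submodule.span K (Set.range v) := by
  obtain ⟨κ, a, ha, hs, hl⟩ := exists_linearIndependent' K v
  have : Finite κ := Finite.of_injective a ha
  have := Fintype.ofFinite κ
  have hc : Fintype.card κ = k := by
    rw [← hk, ← hs, finrank_span_eq_card hl]
  let e := Fintype.equivFinOfCardEq hc
  refine ⟨a ∘ e.symm, hl.comp _ e.symm.injective, ?_⟩
  rw [← Function.comp_assoc, e.symm.surjective.range_comp, hs]

/-- Every matrix over a field has an invertible square submatrix through which it factors. -/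
theorem exists_submatrix_factorization {m ι : Type*} [Fintype m] [Fintype ι] (C : Matrix m ι K) :
    ∃ (k : Fin (Fintype.card m + 1)) (f : Fin k → m) (g : Fin k → ι),
      (C.submatrix f g).det ≠ 0 ∧
      C.submatrix id g * (C.submatrix f g).adjugate * C.submatrix f id =
        (C.submatrix f g).det • C := by
  obtain ⟨k, hk⟩ : ∃ k, Module.finrank K (Submodule.span K (Set.range C.row)) = k := ⟨_, rfl⟩
  obtain ⟨f, hfl, hfs⟩ := exists_fin_basis_of_range C.row hk
  have hkm : k ≤ Fintype.card m := hk ▸ finrank_range_le_card _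
  -- The `k` selected rows are independent, so their column rank is also `k`, and `k` of their
  -- columns form an invertible block.
  have hr : Module.finrank K (Submodule.span K (Set.range (C.submatrix f id).col)) = k := by
    rw [← Matrix.rank_eq_finrank_span_cols]
    exact (LinearIndependent.rank_matrix (M := C.submatrix f id) hfl).trans (Fintype.card_fin _)
  obtain ⟨g, hgl, -⟩ := exists_fin_basis_of_range (C.submatrix f id).col hr
  refine ⟨⟨k, Nat.lt_succ_of_le hkm⟩, f, g, ?_, ?_⟩
  · have : IsUnit (C.submatrix f g) := Matrix.linearIndependent_cols_iff_isUnit.1 hgl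
    exact ((Matrix.isUnit_iff_isUnit_det _).1 this).ne_zero
  -- With `C = t * C_f` and `M` the block, `C_g = t * M`; then `M * adj M = det M` gives the
  -- factorization.
  · have hT : ∀ i, ∃ t : Fin k → K, ∑ l, t l • C (f l) = C i := fun i => by
      have : C i ∈ Submodule.span K (Set.range (C.row ∘ f)) := by
        rw [hfs]; exact Submodule.subset_span ⟨i, rfl⟩
      exact (Submodule.mem_span_range_iff_exists_fun K).1 this
    choose t ht using hT
    have hC : C = Matrix.of t * C.submatrix f id := by
      ext i j
      rw [← ht i]
      simp [Matrix.mul_apply]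
    have hCg : C.submatrix id g = Matrix.of t * C.submatrix f g := by
      ext i j
      exact congrFun (congrFun hC i) (g j)
    rw [hCg, Matrix.mul_assoc (Matrix.of t), Matrix.mul_adjugate, Matrix.mul_smul, Matrix.mul_one,
      Matrix.smul_mul, ← hC]

end LinearAlgebra

/-- The matrix whose column space is the kernel of `C` if `C` factors through its submatrix with
rows `f` and columns `g`. -/
def kerMatrix {R m ι κ : Type*} [CommRing R] [Fintype ι] [DecidableEq ι] [Fintype κ]
    [DecidableEq κ] (C : Matrix m ι R) (f : κ → m) (g : κ → ι) : Matrix ι ι R :=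
  (C.submatrix f g).det • 1 -
    (1 : Matrix ι ι R).submatrix id g * (C.submatrix f g).adjugate * C.submatrix f id

/-- The matrix whose kernel is the column space of `C` if `C` factors through its submatrix with
rows `f` and columns `g`. -/
def cokerMatrix {R m ι κ : Type*} [CommRing R] [Fintype m] [DecidableEq m] [Fintype κ]
    [DecidableEq κ] (C : Matrix m ι R) (f : κ → m) (g : κ → ι) : Matrix m m R :=
  (C.submatrix f g).det • 1 -
    C.submatrix id g * (C.submatrix f g).adjugate * (1 : Matrix m m R).submatrix f id

/-- The difference of the two sides of the factorization through a submatrix. -/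
def factorDefect {R m ι κ : Type*} [CommRing R] [Fintype κ]
    [DecidableEq κ] (C : Matrix m ι R) (f : κ → m) (g : κ → ι) : Matrix m ι R :=
  (C.submatrix f g).det • C -
    C.submatrix id g * (C.submatrix f g).adjugate * C.submatrix f id

/-! ### Division-free matrices for kernels and column spaces. -/

section KernelMatrices

variable {R S m ι κ : Type*} [CommRing R] [CommRing S] [Fintype κ] [DecidableEq κ]

theorem mul_kerMatrix [Fintype ι] [DecidableEq ι] (C : Matrix m ι R) (f : κ → m) (g : κ → ι) :
    C * kerMatrix C f g = factorDefect C f g := by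
  rw [kerMatrix, factorDefect, Matrix.mul_sub, Matrix.mul_smul, Matrix.mul_one,
    ← Matrix.mul_assoc, ← Matrix.mul_assoc]
  congr 3
  ext i j
  simp [Matrix.mul_apply, Matrix.one_apply]

theorem cokerMatrix_mul [Fintype m] [DecidableEq m] (C : Matrix m ι R) (f : κ → m) (g : κ → ι) :
    cokerMatrix C f g * C = factorDefect C f g := by
  rw [cokerMatrix, factorDefect, Matrix.sub_mul, Matrix.smul_mul, Matrix.one_mul,
    Matrix.mul_assoc]
  congr 2
  ext i j
  simp [Matrix.mul_apply, Matrix.one_apply]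

theorem map_adjugate_submatrix (φ : R →+* S) (C : Matrix m ι R) (f : κ → m) (g : κ → ι) :
    (C.submatrix f g).adjugate.map φ = ((C.map φ).submatrix f g).adjugate :=
  φ.map_adjugate _

theorem map_det_submatrix (φ : R →+* S) (C : Matrix m ι R) (f : κ → m) (g : κ → ι) :
    φ (C.submatrix f g).det = ((C.map φ).submatrix f g).det :=
  φ.map_det _

/-- Only determinants and adjugates occur, never inverses, so one symbolic matrix specializes
correctly at every point. -/
theorem kerMatrix_map [Fintype ι] [DecidableEq ι] (φ : R →+* S) (C : Matrix m ι R) (f : κ → m)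
    (g : κ → ι) : (kerMatrix C f g).map φ = kerMatrix (C.map φ) f g := by
  rw [kerMatrix, kerMatrix, Matrix.map_sub φ (map_sub φ), Matrix.map_mul, Matrix.map_mul,
    Matrix.map_smul' φ _ _ (map_mul φ), map_adjugate_submatrix, map_det_submatrix,
    ← Matrix.submatrix_map, ← Matrix.submatrix_map, Matrix.map_one φ φ.map_zero φ.map_one]

theorem cokerMatrix_map [Fintype m] [DecidableEq m] (φ : R →+* S) (C : Matrix m ι R) (f : κ → m)
    (g : κ → ι) : (cokerMatrix C f g).map φ = cokerMatrix (C.map φ) f g := by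
  rw [cokerMatrix, cokerMatrix, Matrix.map_sub φ (map_sub φ), Matrix.map_mul, Matrix.map_mul,
    Matrix.map_smul' φ _ _ (map_mul φ), map_adjugate_submatrix, map_det_submatrix,
    ← Matrix.submatrix_map, ← Matrix.submatrix_map, Matrix.map_one φ φ.map_zero φ.map_one]

theorem factorDefect_map (φ : R →+* S) (C : Matrix m ι R) (f : κ → m)
    (g : κ → ι) : (factorDefect C f g).map φ = factorDefect (C.map φ) f g := by
  have hs : ((C.submatrix f g).det • C).map φ = φ (C.submatrix f g).det • C.map φ := by
    ext i j
    simp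
  rw [factorDefect, factorDefect, Matrix.map_sub φ (map_sub φ), Matrix.map_mul, Matrix.map_mul, hs,
    map_adjugate_submatrix, map_det_submatrix,
    ← Matrix.submatrix_map, ← Matrix.submatrix_map]

variable {K : Type*} [Field K]

/-- On the kernel of `C` the matrix `kerMatrix C f g` acts as the nonzero scalar `det`, and `C`
times it is the defect, which is zero. -/
theorem ker_mulVecLin_eq_range_kerMatrix [Fintype ι] [DecidableEq ι] (C : Matrix m ι K)
    (f : κ → m) (g : κ → ι) (hdet : (C.submatrix f g).det ≠ 0) (hC : factorDefect C f g = 0) :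
    LinearMap.ker C.mulVecLin = LinearMap.range (kerMatrix C f g).mulVecLin := by
  ext x
  simp only [LinearMap.mem_ker, LinearMap.mem_range, Matrix.mulVecLin_apply]
  constructor
  · intro hx
    have hfx : C.submatrix f id *ᵥ x = 0 := by
      ext i
      exact congrFun hx (f i)
    refine ⟨(C.submatrix f g).det⁻¹ • x, ?_⟩
    rw [Matrix.mulVec_smul, kerMatrix, Matrix.sub_mulVec, Matrix.smul_mulVec, Matrix.one_mulVec,
      ← Matrix.mulVec_mulVec, hfx, Matrix.mulVec_zero, sub_zero, smul_smul, inv_mul_cancel₀ hdet,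
      one_smul]
  · rintro ⟨y, rfl⟩
    rw [Matrix.mulVec_mulVec, mul_kerMatrix, hC, Matrix.zero_mulVec]

/-- A vector killed by `cokerMatrix C f g` satisfies `det • x = C_g (…)`, so it lies in the span of
the columns `g` of `C`. -/
theorem range_mulVecLin_eq_ker_cokerMatrix [Fintype m] [DecidableEq m] [Fintype ι]
    (C : Matrix m ι K)
    (f : κ → m) (g : κ → ι) (hdet : (C.submatrix f g).det ≠ 0) (hC : factorDefect C f g = 0) :
    LinearMap.range C.mulVecLin = LinearMap.ker (cokerMatrix C f g).mulVecLin := by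
  classical
  ext x
  simp only [LinearMap.mem_ker, LinearMap.mem_range, Matrix.mulVecLin_apply]
  constructor
  · rintro ⟨y, rfl⟩
    rw [Matrix.mulVec_mulVec, cokerMatrix_mul, hC, Matrix.zero_mulVec]
  · intro hx
    rw [cokerMatrix, Matrix.sub_mulVec, Matrix.smul_mulVec, Matrix.one_mulVec, sub_eq_zero,
      Matrix.mul_assoc, ← Matrix.mulVec_mulVec] at hx
    have hg : C.submatrix id g = C * (1 : Matrix ι ι K).submatrix id g := by
      ext i j
      simp [Matrix.mul_apply, Matrix.one_apply]
    rw [hg, ← Matrix.mulVec_mulVec] at hx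
    refine ⟨(C.submatrix f g).det⁻¹ • ((1 : Matrix ι ι K).submatrix id g *ᵥ
      (((C.submatrix f g).adjugate * (1 : Matrix m m K).submatrix f id) *ᵥ x)), ?_⟩
    rw [Matrix.mulVec_smul, ← hx, smul_smul, inv_mul_cancel₀ hdet, one_smul]

theorem exists_factorDefect_eq_zero [Fintype m] [Fintype ι] (C : Matrix m ι K) :
    ∃ (k : Fin (Fintype.card m + 1)) (f : Fin k → m) (g : Fin k → ι),
      (C.submatrix f g).det ≠ 0 ∧ factorDefect C f g = 0 := by
  obtain ⟨k, f, g, h, h'⟩ := exists_submatrix_factorization C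
  exact ⟨k, f, g, h, sub_eq_zero.2 h'.symm⟩

end KernelMatrices

section Zeros

/-! ### Sets and functions determined by the vanishing of finitely many ring elements -/

variable {F R X : Type*} [Field F] [CommRing R] (ev : X → R →+* F)

/-- The points `x` and `y` have the same zeros among the members of `L`. -/
def SameZeros (L : Finset R) (x y : X) : Prop := ∀ p ∈ L, ev x p = 0 ↔ ev y p = 0

/-- Validity of `P` at `x` depends only on the zeros at `x` among a finite set of ring elements. -/
def Determined (P : X → Prop) : Prop :=
  ∃ L : Finset R, ∀ x y, SameZeros ev L x y → P x → P y

variable {ev}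

theorem SameZeros.refl (L : Finset R) (x : X) : SameZeros ev L x x := fun _ _ => Iff.rfl

theorem SameZeros.symm {L : Finset R} {x y : X} (h : SameZeros ev L x y) : SameZeros ev L y x :=
  fun p hp => (h p hp).symm

theorem SameZeros.trans {L : Finset R} {x y z : X} (h : SameZeros ev L x y)
    (h' : SameZeros ev L y z) : SameZeros ev L x z :=
  fun p hp => (h p hp).trans (h' p hp)

theorem SameZeros.mono {L L' : Finset R} (hL : L ⊆ L') {x y : X} (h : SameZeros ev L' x y) :
    SameZeros ev L x y :=
  fun p hp => h p (hL hp)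

theorem SameZeros.map_eq_zero {L : Finset R} {x y : X} (h : SameZeros ev L x y) {m n : Type*}
    {A : Matrix m n R} (hA : ∀ i j, A i j ∈ L) (hx : A.map (ev x) = 0) : A.map (ev y) = 0 := by
  ext i j
  exact (h _ (hA i j)).1 (congrFun (congrFun hx i) j)

/-- A choice of a finite set for each point can be made uniformly on the finitely many classes. -/
theorem exists_uniform_refinement (L : Finset R) (Q : X → Finset R → Prop)
    (hQ : ∀ x, ∃ L', Q x L') :
    ∃ L'', L ⊆ L'' ∧ ∀ x, ∃ x₀, SameZeros ev L x₀ x ∧ ∃ L' ⊆ L'', Q x₀ L' := by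
  classical
  choose L' hL' using hQ
  let zeros (x : X) : Finset R := L.filter fun p => ev x p = 0
  -- One representative is chosen for each realized zero pattern `T ⊆ L`; patterns that do not occur
  -- contribute nothing.
  let L₁ (T : Finset R) : Finset R := if h : ∃ x, zeros x = T then L' h.choose else ∅
  refine ⟨L ∪ L.powerset.biUnion L₁, Finset.subset_union_left, fun x => ?_⟩
  have h : ∃ y, zeros y = zeros x := ⟨x, rfl⟩
  refine ⟨h.choose, fun p hp => ?_, L' h.choose, ?_, hL' _⟩
  · have := congrArg (p ∈ ·) h.choose_spec
    simpa [zeros, hp] using this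
  · refine Finset.Subset.trans ?_ Finset.subset_union_right
    have h₁ : L₁ (zeros x) = L' h.choose := dif_pos h
    rw [← h₁]
    exact Finset.subset_biUnion_of_mem L₁ (Finset.mem_powerset.2 (Finset.filter_subset _ _))

/-- Since `SameZeros` is symmetric, the one-sided transfer in `Determined` works backwards too,
which the premise requires. -/
theorem Determined.imp {P Q : X → Prop} (hP : Determined ev P) (hQ : Determined ev Q) :
    Determined ev fun x => P x → Q x := by
  classical
  obtain ⟨L, hL⟩ := hP
  obtain ⟨L', hL'⟩ := hQ
  exact ⟨L ∪ L', fun x y h hx hy => hL' x y (h.mono Finset.subset_union_right)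
    (hx (hL y x (h.mono Finset.subset_union_left).symm hy))⟩

theorem Determined.const (p : Prop) : Determined ev fun _ => p := ⟨∅, fun _ _ _ h => h⟩

theorem Determined.and {P Q : X → Prop} (hP : Determined ev P) (hQ : Determined ev Q) :
    Determined ev fun x => P x ∧ Q x := by
  classical
  obtain ⟨L, hL⟩ := hP
  obtain ⟨L', hL'⟩ := hQ
  exact ⟨L ∪ L', fun x y h hx => ⟨hL x y (h.mono Finset.subset_union_left) hx.1,
    hL' x y (h.mono Finset.subset_union_right) hx.2⟩⟩

theorem Determined.forall {ι : Type*} [Finite ι] {P : ι → X → Prop}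
    (hP : ∀ i, Determined ev (P i)) : Determined ev fun x => ∀ i, P i x := by
  classical
  have := Fintype.ofFinite ι
  choose L hL using hP
  exact ⟨Finset.univ.biUnion L, fun x y h hx i =>
    hL i x y (h.mono (Finset.subset_biUnion_of_mem L (Finset.mem_univ i))) (hx i)⟩

theorem Determined.eq_zero (p : R) : Determined ev fun x => ev x p = 0 :=
  ⟨{p}, fun _ _ h => (h p (Finset.mem_singleton_self p)).1⟩

end Zeros

section Param

/-! ### Piecewise parametrized families of subspaces -/

variable {F R X : Type*} [Field F] [CommRing R] (ev : X → R →+* F) {m : Type*}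

/-- The family `W` of subspaces is piecewise given by the column space of a matrix over `R`, the
pieces being determined by the zeros of finitely many elements of `R`. -/
def Parametrized (W : X → Submodule F (m → F)) : Prop :=
  ∃ L : Finset R, ∀ x₀, ∃ (ι : Type) (_ : Fintype ι) (B : Matrix m ι R),
    ∀ x, SameZeros ev L x₀ x → W x = LinearMap.range (B.map (ev x)).mulVecLin

variable {ev}

theorem Parametrized.of_matrix {ι : Type} [Fintype ι] (B : Matrix m ι R) :
    Parametrized ev fun x => LinearMap.range (B.map (ev x)).mulVecLin :=
  ⟨∅, fun _ => ⟨ι, inferInstance, B, fun _ _ => rfl⟩⟩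

theorem Parametrized.bot : Parametrized ev fun _ => (⊥ : Submodule F (m → F)) := by
  refine ⟨∅, fun _ => ⟨Empty, inferInstance, 0, fun x _ => ?_⟩⟩
  rw [eq_comm, LinearMap.range_eq_bot]
  exact Subsingleton.elim _ _

theorem range_mulVecLin_fromCols {ι ι' : Type*} [Fintype ι] [Fintype ι'] (A : Matrix m ι F)
    (B : Matrix m ι' F) : LinearMap.range (Matrix.fromCols A B).mulVecLin =
      LinearMap.range A.mulVecLin ⊔ LinearMap.range B.mulVecLin := by
  rw [Matrix.range_mulVecLin, Matrix.range_mulVecLin, Matrix.range_mulVecLin,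
    ← Submodule.span_union]
  congr 1
  exact Sum.range_eq _

theorem Parametrized.sup {W W' : X → Submodule F (m → F)} (h : Parametrized ev W)
    (h' : Parametrized ev W') : Parametrized ev fun x => W x ⊔ W' x := by
  classical
  obtain ⟨L, hL⟩ := h
  obtain ⟨L', hL'⟩ := h'
  refine ⟨L ∪ L', fun x₀ => ?_⟩
  obtain ⟨ι, _, B, hB⟩ := hL x₀
  obtain ⟨ι', _, B', hB'⟩ := hL' x₀
  refine ⟨ι ⊕ ι', inferInstance, Matrix.fromCols B B', fun x hx => ?_⟩
  dsimp only
  rw [hB x (hx.mono Finset.subset_union_left), hB' x (hx.mono Finset.subset_union_right),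
    ← range_mulVecLin_fromCols]
  congr 2
  ext i j
  cases j <;> rfl

/-- A finite set of ring elements controlling the submatrices through which `C` factors. -/
theorem exists_control [Fintype m] {ι : Type*} [Fintype ι] (C : Matrix m ι R)
    (D : ∀ {k : ℕ}, (Fin k → m) → (Fin k → ι) → Finset R) :
    ∃ L : Finset R, ∀ x, ∃ (k : ℕ) (f : Fin k → m) (g : Fin k → ι), D f g ⊆ L ∧
      ∀ y, SameZeros ev L x y →
        ((C.map (ev y)).submatrix f g).det ≠ 0 ∧ factorDefect (C.map (ev y)) f g = 0 := by
  classical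
  let I := (k : Fin (Fintype.card m + 1)) × (Fin k → m) × (Fin k → ι)
  let E (i : I) : Finset R := insert (C.submatrix i.2.1 i.2.2).det
    (Finset.univ.image (fun p : m × ι => factorDefect C i.2.1 i.2.2 p.1 p.2) ∪ D i.2.1 i.2.2)
  refine ⟨Finset.univ.biUnion E, fun x => ?_⟩
  obtain ⟨k, f, g, h, h'⟩ := exists_factorDefect_eq_zero (C.map (ev x))
  have hE : E ⟨k, f, g⟩ ⊆ Finset.univ.biUnion E :=
    Finset.subset_biUnion_of_mem E (Finset.mem_univ _)
  refine ⟨k, f, g, ?_, fun y hy => ?_⟩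
  · exact fun p hp => hE (Finset.mem_insert_of_mem (Finset.mem_union_right _ hp))
  · replace hy := hy.mono hE
    constructor
    · rw [← map_det_submatrix] at h ⊢
      exact fun h0 => h ((hy _ (Finset.mem_insert_self _ _)).2 h0)
    · rw [← factorDefect_map] at h' ⊢
      refine hy.map_eq_zero (fun i j => ?_) h'
      exact Finset.mem_insert_of_mem (Finset.mem_union_left _
        (Finset.mem_image.2 ⟨(i, j), Finset.mem_univ _, rfl⟩))

/-- Writing the larger column space as the kernel of a cokernel matrix turns inclusion into the
vanishing of a product matrix, whose entries are added to the control set. -/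
theorem Parametrized.determined_le [Fintype m] {W W' : X → Submodule F (m → F)}
    (h : Parametrized ev W) (h' : Parametrized ev W') : Determined ev fun x => W x ≤ W' x := by
  classical
  obtain ⟨L₁, hL₁⟩ := h
  obtain ⟨L₂, hL₂⟩ := h'
  let Q (x₀ : X) (L : Finset R) : Prop := ∀ x, SameZeros ev (L₁ ∪ L₂) x₀ x → ∀ y,
    SameZeros ev (L₁ ∪ L₂) x₀ y → SameZeros ev L x y → W x ≤ W' x → W y ≤ W' y
  obtain ⟨L, hL, hQ⟩ := exists_uniform_refinement (ev := ev) (L₁ ∪ L₂) Q fun x₀ => by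
    obtain ⟨ι₁, _, B₁, hB₁⟩ := hL₁ x₀
    obtain ⟨ι₂, _, B₂, hB₂⟩ := hL₂ x₀
    obtain ⟨L, hL⟩ := exists_control (ev := ev) B₂ fun f g =>
      Finset.univ.image fun p : m × ι₁ => (cokerMatrix B₂ f g * B₁) p.1 p.2
    refine ⟨L, fun x hx y hy hxy hle => ?_⟩
    obtain ⟨k, f, g, hD, hfg⟩ := hL x
    have key : ∀ z, SameZeros ev (L₁ ∪ L₂) x₀ z → SameZeros ev L x z →
        (W z ≤ W' z ↔ (cokerMatrix B₂ f g * B₁).map (ev z) = 0) := fun z hz hxz => by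
      obtain ⟨hdet, hC⟩ := hfg z hxz
      rw [hB₁ z (hz.mono Finset.subset_union_left), hB₂ z (hz.mono Finset.subset_union_right),
        range_mulVecLin_eq_ker_cokerMatrix _ f g hdet hC, LinearMap.range_le_ker_iff,
        ← Matrix.mulVecLin_mul, Matrix.map_mul, cokerMatrix_map]
      rw [← Matrix.toLin'_apply', LinearEquiv.map_eq_zero_iff]
    refine (key y hy hxy).2 (hxy.map_eq_zero (fun i j => hD ?_) ((key x hx (.refl _ _)).1 hle))
    exact Finset.mem_image.2 ⟨(i, j), Finset.mem_univ _, rfl⟩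
  refine ⟨L, fun x y hxy hle => ?_⟩
  obtain ⟨x₀, hx₀, L', hL', hQ'⟩ := hQ x
  exact hQ' x hx₀ y (hx₀.trans (hxy.mono hL)) (hxy.mono hL') hle

/-- On each piece the kernel is the column space of a `kerMatrix`; the pieces are refined so that
one choice of submatrix is valid throughout. -/
theorem Parametrized.ker {m : Type} [Fintype m] {W W' : X → Submodule F (m → F)} (h : Parametrized ev W)
    (hW : ∀ {ι : Type} [Fintype ι] (B : Matrix m ι R), ∃ C : Matrix ι m R, ∀ x,
      W x = LinearMap.range (B.map (ev x)).mulVecLin →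
        W' x = LinearMap.ker (C.map (ev x)).mulVecLin) :
    Parametrized ev W' := by
  classical
  obtain ⟨L₁, hL₁⟩ := h
  let Q (x₀ : X) (L : Finset R) : Prop := ∀ x, SameZeros ev L₁ x₀ x →
    ∃ (ι : Type) (_ : Fintype ι) (B : Matrix m ι R), ∀ y, SameZeros ev L₁ x₀ y →
      SameZeros ev L x y → W' y = LinearMap.range (B.map (ev y)).mulVecLin
  obtain ⟨L, hL, hQ⟩ := exists_uniform_refinement (ev := ev) L₁ Q fun x₀ => by
    obtain ⟨ι, _, B, hB⟩ := hL₁ x₀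
    obtain ⟨C, hC⟩ := hW B
    obtain ⟨L, hL⟩ := exists_control (ev := ev) C fun _ _ => ∅
    refine ⟨L, fun x hx => ?_⟩
    obtain ⟨k', f, g, -, hfg⟩ := hL x
    refine ⟨m, inferInstance, kerMatrix C f g, fun y hy hxy => ?_⟩
    obtain ⟨hdet, hC'⟩ := hfg y hxy
    rw [hC y (hB y hy), ker_mulVecLin_eq_range_kerMatrix _ f g hdet hC', ← kerMatrix_map]
  refine ⟨L, fun x => ?_⟩
  obtain ⟨x₀, hx₀, L', hL', hQ'⟩ := hQ x
  obtain ⟨ι, hι, B, hB⟩ := hQ' x hx₀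
  exact ⟨ι, hι, B, fun y hxy => hB y (hx₀.trans (hxy.mono hL)) (hxy.mono hL')⟩

end Param

/-! ### Terms and quantifier free formulas over parametrized families. -/

section Formulas

variable {F R X : Type*} [Field F] [StarRing F] [CommRing R] {ev : X → R →+* F} {d : ℕ}
  {α : Fin d → F}

/-- Orthogonality need only be tested on columns. The form is semilinear in `v`; conjugating, with
`α` self-adjoint, yields equations linear in `v`. -/
theorem perp_range_mulVecLin (hα : ∀ i, star (α i) = α i) {ι : Type*} [Fintype ι]
    (B : Matrix (Fin d) ι F) : perp α (LinearMap.range B.mulVecLin) =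
      LinearMap.ker (Matrix.of fun l i => star (B i l) * α i).mulVecLin := by
  classical
  ext v
  have key : ∀ l, star (((Matrix.of fun l i => star (B i l) * α i) *ᵥ v) l) =
      form α v (B.col l) := fun l => by
    simp [Matrix.mulVec, dotProduct, form, hα, mul_comm, mul_left_comm]
  have hform : ∀ w, form α v (B *ᵥ w) = ∑ l, form α v (B.col l) * w l := fun w => by
    simp only [form, Matrix.mulVec, dotProduct, Finset.mul_sum, Finset.sum_mul, Matrix.col_apply]
    rw [Finset.sum_comm]
    simp only [mul_assoc]
  rw [LinearMap.mem_ker, Matrix.mulVecLin_apply]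
  constructor
  · intro hv
    ext l
    rw [← star_inj, key, Pi.zero_apply, star_zero]
    refine hv _ ⟨Pi.single l 1, ?_⟩
    simp
  · rintro hv _ ⟨w, rfl⟩
    rw [Matrix.mulVecLin_apply, hform]
    refine Finset.sum_eq_zero fun l _ => ?_
    rw [← key, hv, Pi.zero_apply, star_zero, zero_mul]

theorem Parametrized.perp (hα : ∀ i, star (α i) = α i)
    (hstar : ∀ p : R, ∃ q, ∀ x, ev x q = star (ev x p)) (hconst : ∀ i, ∃ c, ∀ x, ev x c = α i)
    {W : X → Submodule F (Fin d → F)} (h : Parametrized ev W) :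
    Parametrized ev fun x => PluckerQF.perp α (W x) := by
  choose s hs using hstar
  choose c hc using hconst
  refine h.ker (fun B => ⟨Matrix.of fun l i => s (B i l) * c i, fun x hx => ?_⟩)
  rw [hx, perp_range_mulVecLin hα]
  congr 2
  ext l i
  simp [hs, hc]

theorem Parametrized.term_realize (hα : ∀ i, star (α i) = α i)
    (hstar : ∀ p : R, ∃ q, ∀ x, ev x q = star (ev x p)) (hconst : ∀ i, ∃ c, ∀ x, ev x c = α i)
    {σ : Type*} (u : X → σ → SubspaceLattice α)
    (hu : ∀ s, Parametrized ev fun x => (u x s).toSubmodule) (t : latLang.Term σ) :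
    Parametrized ev fun x => (t.realize (u x)).toSubmodule := by
  induction t with
  | var s => exact hu s
  | func f ts ih =>
    cases f with
    | zero => exact Parametrized.bot
    | perp => exact (ih 0).perp hα hstar hconst
    | add => exact (ih 0).sup (ih 1)

/-- The only atomic formulas are equations of terms, and an equation of subspaces is a pair of
inclusions. -/
theorem Determined.qf_realize (hα : ∀ i, star (α i) = α i)
    (hstar : ∀ p : R, ∃ q, ∀ x, ev x q = star (ev x p)) (hconst : ∀ i, ∃ c, ∀ x, ev x c = α i)
    {n : ℕ} (u : X → Fin n → SubspaceLattice α)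
    (hu : ∀ s, Parametrized ev fun x => (u x s).toSubmodule)
    {φ : latLang.Formula (Fin n)} (hφ : φ.IsQF) : Determined ev fun x => φ.Realize (u x) := by
  have hterm : ∀ t : latLang.Term (Fin n ⊕ Fin 0), Parametrized ev fun x =>
      (t.realize (Sum.elim (u x) default)).toSubmodule := fun t =>
    Parametrized.term_realize hα hstar hconst (fun x => Sum.elim (u x) default)
      (Sum.rec hu fun i => i.elim0) t
  unfold FirstOrder.Language.Formula.Realize
  induction hφ with
  | falsum => exact .const False
  | of_isAtomic h =>
    cases h with
    | equal t₁ t₂ =>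
      have := ((hterm t₁).determined_le (hterm t₂)).and ((hterm t₂).determined_le (hterm t₁))
      simp only [← le_antisymm_iff] at this
      simp only [FirstOrder.Language.BoundedFormula.realize_bdEqual]
      exact this
    | rel r => exact nomatch r
  | imp _ _ h₁ h₂ => exact h₁.imp h₂

end Formulas

/-! ### Recovering a subspace from normalized Plücker coordinates. -/

section Plucker

variable {R S : Type*} [CommRing R] [CommRing S] {d k : ℕ}

/-- The strictly increasing tuple obtained by sorting an injective tuple. -/
def sortedIdx (f : Fin k → Fin d) (hf : Function.Injective f) : Idx d k :=
  OrderEmbedding.ofStrictMono (f ∘ Tuple.sort f)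
    ((Tuple.monotone_sort f).strictMono_of_injective (hf.comp (Tuple.sort f).injective))

open Classical in
/-- The extension of a coordinate vector to an alternating function of all tuples of indices. -/
noncomputable def altExt (y : Idx d k → R) (f : Fin k → Fin d) : R :=
  if h : Function.Injective f then
    ((Equiv.Perm.sign (Tuple.sort f) : ℤ) : R) * y (sortedIdx f h) else 0

/-- Sorting the rows costs a sign, which `altExt` cancels; a repeated row makes the determinant
zero. -/
theorem altExt_minors (T : Matrix (Fin d) (Fin k) R) (f : Fin k → Fin d) :
    altExt (fun I => (T.submatrix I id).det) f = (T.submatrix f id).det := by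
  unfold altExt
  split_ifs with h
  · have : (T.submatrix (sortedIdx f h) id).det =
        ((Equiv.Perm.sign (Tuple.sort f) : ℤ) : R) * (T.submatrix f id).det :=
      Matrix.det_permute (Tuple.sort f) (T.submatrix f id)
    dsimp only
    rw [this, ← mul_assoc, ← Int.cast_mul, ← Units.val_mul, Int.units_mul_self]
    simp
  · simp only [Function.Injective, not_forall] at h
    obtain ⟨a, b, hab, hne⟩ := h
    refine (Matrix.det_zero_of_row_eq hne ?_).symm
    ext j
    simp [hab]

theorem altExt_apply (y : Idx d k → R) (J : Idx d k) : altExt y J = y J := by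
  have hs : Tuple.sort J = Equiv.refl _ := Tuple.sort_eq_refl_iff_monotone.2 J.monotone
  have : sortedIdx J J.injective = J := by
    ext i
    simp [sortedIdx, hs]
  rw [altExt, dif_pos J.injective, hs, this]
  simp

theorem map_altExt (φ : R →+* S) (y : Idx d k → R) (f : Fin k → Fin d) :
    φ (altExt y f) = altExt (fun I => φ (y I)) f := by
  unfold altExt
  split_ifs <;> simp

/-- The matrix reconstructed from Plücker coordinates `y` with `y J = 1`: it has the identity
matrix in the rows `J`. -/
noncomputable def pluckerMatrix (J : Idx d k) (y : Idx d k → R) : Matrix (Fin d) (Fin k) R :=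
  Matrix.of fun i l => altExt y (Function.update J l i)

theorem pluckerMatrix_map (φ : R →+* S) (J : Idx d k) (y : Idx d k → R) :
    (pluckerMatrix J y).map φ = pluckerMatrix J fun I => φ (y I) := by
  ext i l
  exact map_altExt φ y _

theorem pluckerMatrix_submatrix {J : Idx d k} {y : Idx d k → R} (hJ : y J = 1) :
    (pluckerMatrix J y).submatrix J id = 1 := by
  ext m l
  rw [Matrix.submatrix_apply, id, pluckerMatrix, Matrix.of_apply]
  by_cases h : m = l
  · rw [h, Function.update_eq_self, altExt_apply, hJ, Matrix.one_apply_eq]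
  · rw [Matrix.one_apply_ne h, altExt, dif_neg]
    intro hinj
    exact h (hinj (by simp [Function.update_of_ne h]))

/-- Replacing row `J l` by row `i` of `T` gives the identity with row `l` replaced by `T i`, whose
determinant is `T i l`. -/
theorem pluckerMatrix_minors {J : Idx d k} {T : Matrix (Fin d) (Fin k) R}
    (hT : T.submatrix J id = 1) :
    pluckerMatrix J (fun I => (T.submatrix I id).det) = T := by
  ext i l
  rw [pluckerMatrix, Matrix.of_apply, altExt_minors]
  have : T.submatrix (Function.update J l i) id = (1 : Matrix _ _ R).updateRow l (T i) := by
    ext m j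
    by_cases h : m = l
    · subst h; simp
    · simp [Function.update_of_ne h, Matrix.updateRow_ne h, ← hT]
  rw [this, ← Matrix.cramer_transpose_apply, Matrix.transpose_one, Matrix.cramer_one]
  rfl

/-- The defect of `y` as a vector of Plücker coordinates with `y J = 1`. -/
noncomputable def pluckerDefect (J : Idx d k) (y : Idx d k → R) (I : Idx d k) : R :=
  -- The convention for `k = 0` demands the zero vector, whereas the empty minor would be 1.
  if k = 0 then y I else y I - ((pluckerMatrix J y).submatrix I id).det

theorem map_pluckerDefect (φ : R →+* S) (J : Idx d k) (y : Idx d k → R) (I : Idx d k) :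
    φ (pluckerDefect J y I) = pluckerDefect J (fun I => φ (y I)) I := by
  unfold pluckerDefect
  split_ifs
  · rfl
  · rw [map_sub, ← pluckerMatrix_map, ← map_det_submatrix]

/-- The coordinate of `r` used for normalization. -/
def pivot (J : Idx d k) (r : Idx d k → R) : R := if k = 0 then 1 else r J

variable {F : Type*} [Field F]

theorem colSpan_eq_range (A : Matrix (Fin d) (Fin d) F) :
    colSpan A = LinearMap.range A.mulVecLin :=
  (Matrix.range_mulVecLin A).symm

theorem exists_columns {U : Submodule F (Fin d → F)} (hU : Module.finrank F U = k) :
    ∃ T : Matrix (Fin d) (Fin k) F, LinearMap.range T.mulVecLin = U := by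
  let b := Module.finBasisOfFinrankEq F U hU
  have h : LinearMap.range (Matrix.of fun i l => (b l : Fin d → F) i).mulVecLin = U := by
    rw [Matrix.range_mulVecLin]
    have h1 : Set.range (Matrix.of fun i l => (b l : Fin d → F) i).col = U.subtype '' Set.range b := by
      rw [← Set.range_comp]
      rfl
    rw [h1, ← Submodule.map_span, b.span_eq, Submodule.map_top, Submodule.range_subtype]
  exact ⟨_, h⟩

/-- If the columns of `T` form a basis of `U`, every `A` spanning `U` factors through `T`, so `r` is
a multiple of the minors of `T`. Right multiplication of `T` by the inverse of its block `J`
normalizes the minors without changing the column space. Conversely the reconstructed matrix has an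
identity block, hence rank `k`. -/
theorem mem_plucker_iff {U : Submodule F (Fin d → F)} {r : Idx d k → F} :
    (Module.finrank F U = k ∧ r ∈ plucker k U) ↔
      ∃ J : Idx d k, pivot J r ≠ 0 ∧ (∀ I, pluckerDefect J (fun I => r I / pivot J r) I = 0) ∧
        LinearMap.range (pluckerMatrix J fun I => r I / pivot J r).mulVecLin = U := by
  rcases Nat.eq_zero_or_pos k with rfl | hk
  · have hrange : ∀ B : Matrix (Fin d) (Fin 0) F, LinearMap.range B.mulVecLin = ⊥ := fun B => by
      rw [LinearMap.range_eq_bot]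
      exact Subsingleton.elim _ _
    simp only [pivot, pluckerDefect, if_true, div_one, hrange, plucker, matrixPlucker,
      Set.mem_singleton_iff, Submodule.finrank_eq_zero, Set.mem_ofPred_eq]
    constructor
    · rintro ⟨rfl, A, -, rfl⟩
      exact ⟨OrderEmbedding.ofIsEmpty, one_ne_zero, fun _ => rfl, rfl⟩
    · rintro ⟨J, -, h, rfl⟩
      refine ⟨rfl, 0, ?_, funext h⟩
      rw [colSpan_eq_range, Matrix.mulVecLin_zero, LinearMap.range_zero]
  · simp only [pivot, pluckerDefect, if_neg hk.ne', plucker, matrixPlucker, Set.mem_ofPred_eq,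
      Set.mem_sdiff, SetLike.mem_coe, Set.mem_singleton_iff, sub_eq_zero]
    constructor
    · rintro ⟨hU, A, hA, hr, hr0⟩
      obtain ⟨T, hT⟩ := exists_columns hU
      have hS : ∀ j, ∃ s : Fin k → F, T *ᵥ s = A.col j := fun j => by
        have : A.col j ∈ LinearMap.range T.mulVecLin := by
          rw [hT, ← hA]
          exact Submodule.subset_span ⟨j, rfl⟩
        exact this
      choose s hs using hS
      have hAT : A = T * (Matrix.of s)ᵀ := by
        ext i j
        exact (congrFun (hs j) i).symm
      have hle : Submodule.span F (Set.range fun j : Idx d k => minors A j) ≤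
          Submodule.span F {fun I : Idx d k => (T.submatrix I id).det} := by
        rw [Submodule.span_le]
        rintro _ ⟨j, rfl⟩
        refine Submodule.mem_span_singleton.2 ⟨((Matrix.of s)ᵀ.submatrix id j).det, ?_⟩
        ext I
        have hA : A.submatrix I j = T.submatrix I id * (Matrix.of s)ᵀ.submatrix id j := by
          rw [hAT]
          rfl
        dsimp only
        rw [minors, hA, Matrix.det_mul, Pi.smul_apply, smul_eq_mul, mul_comm]
      obtain ⟨c, rfl⟩ := Submodule.mem_span_singleton.1 (hle hr)
      obtain ⟨J, hJ⟩ := Function.ne_iff.1 hr0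
      simp only [Pi.smul_apply, smul_eq_mul, Pi.zero_apply] at hJ ⊢
      obtain ⟨hc, hdet⟩ := mul_ne_zero_iff.1 hJ
      let E := T.submatrix J id
      have hE : IsUnit E.det := isUnit_iff_ne_zero.2 hdet
      let T' := T * E⁻¹
      have hT'J : T'.submatrix J id = 1 := Matrix.mul_nonsing_inv E hE
      have hy : (fun I : Idx d k => c * (T.submatrix I id).det / (c * (T.submatrix J id).det)) =
          fun I : Idx d k => (T'.submatrix I id).det := by
        ext I
        have : T'.submatrix I id = T.submatrix I id * E⁻¹ := rfl
        rw [this, Matrix.det_mul, Matrix.det_nonsing_inv, Ring.inverse_eq_inv',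
          mul_div_mul_left _ _ hc, div_eq_mul_inv]
      refine ⟨J, hJ, ?_, ?_⟩
      · rw [hy, pluckerMatrix_minors hT'J]
        exact fun I => congrFun hy I
      · rw [hy, pluckerMatrix_minors hT'J, ← hT, Matrix.mulVecLin_mul]
        refine LinearMap.range_comp_of_range_eq_top _ (LinearMap.range_eq_top.2 fun v => ⟨E *ᵥ v, ?_⟩)
        rw [Matrix.mulVecLin_apply, Matrix.mulVec_mulVec, Matrix.nonsing_inv_mul E hE,
          Matrix.one_mulVec]
    · rintro ⟨J, hJ, hdet, rfl⟩
      set B := pluckerMatrix J fun I => r I / r J with hB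
      have hBJ : B.submatrix J id = 1 := pluckerMatrix_submatrix (div_self hJ)
      -- `B * S` is the required square matrix: the columns of `B` in positions `J`, padded with
      -- zeros.
      let S : Matrix (Fin k) (Fin d) F := (1 : Matrix (Fin d) (Fin d) F).submatrix J id
      have hSB : S * B = 1 := by
        rw [← hBJ]
        ext i j
        simp [S, Matrix.mul_apply, Matrix.one_apply]
      have hSS : S * Sᵀ = 1 := by
        ext i j
        simp [S, Matrix.mul_apply, Matrix.one_apply]
      have hSJ : S.submatrix id J = 1 := by
        ext i j
        simp [S, Matrix.one_apply]
      refine ⟨?_, B * S, ?_, ?_, ?_⟩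
      · rw [LinearMap.finrank_range_of_inj, Module.finrank_fin_fun]
        refine Function.LeftInverse.injective (g := S.mulVecLin) fun v => ?_
        rw [Matrix.mulVecLin_apply, Matrix.mulVecLin_apply, Matrix.mulVec_mulVec, hSB,
          Matrix.one_mulVec]
      · rw [colSpan_eq_range, Matrix.mulVecLin_mul]
        refine LinearMap.range_comp_of_range_eq_top _ (LinearMap.range_eq_top.2 fun v => ⟨Sᵀ *ᵥ v, ?_⟩)
        rw [Matrix.mulVecLin_apply, Matrix.mulVec_mulVec, hSS, Matrix.one_mulVec]
      · have : r = r J • minors (B * S) J := by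
          ext I
          have h1 : (B * S).submatrix I J = B.submatrix I id * S.submatrix id J := rfl
          rw [Pi.smul_apply, minors, h1, hSJ, Matrix.mul_one, ← hdet I, smul_eq_mul,
            mul_div_cancel₀ _ hJ]
        rw [this]
        exact Submodule.smul_mem _ _ (Submodule.subset_span ⟨J, rfl⟩)
      · rintro rfl
        exact hJ rfl

theorem smul_mem_plucker {U : Submodule F (Fin d → F)} {r : Idx d k → F} (hr : r ∈ plucker k U)
    {c : F} (hc : c ≠ 0) : c • r ∈ plucker k U := by
  obtain ⟨A, hA, hr⟩ := hr
  refine ⟨A, hA, ?_⟩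
  unfold matrixPlucker at hr ⊢
  split_ifs at hr ⊢
  · rw [Set.mem_singleton_iff] at hr ⊢
    rw [hr, smul_zero]
  · exact ⟨Submodule.smul_mem _ _ hr.1, smul_ne_zero hc hr.2⟩

theorem plucker_subset_grassmann {U : Submodule F (Fin d → F)} (hU : Module.finrank F U = k) :
    plucker k U ⊆ grassmann F d k := by
  rintro r ⟨A, hA, hr⟩
  refine ⟨A, ?_, hr⟩
  rw [← hU, ← hA, colSpan_eq_range, Matrix.rank]

theorem eq_zero_of_mem_grassmann {r : Idx d k → F} (hr : r ∈ grassmann F d k) (hk : k = 0) :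
    r = 0 := by
  obtain ⟨A, -, hr⟩ := hr
  rw [matrixPlucker, if_pos hk] at hr
  exact hr

end Plucker

/-! ### Conjugates and constants among basic terms. -/

section BasicTerms

variable {F : Type*} [Field F] [StarRing F] {d : ℕ} {α : Fin d → F} {σ : Type}

/-- The value of basic terms as a ring homomorphism. -/
noncomputable def valueHom (α : Fin d → F) (x : σ → F) : BasicTerm d σ →+* F :=
  MvPolynomial.eval₂Hom (MvPolynomial.eval₂Hom (Int.castRingHom F) α)
    (Sum.elim x fun s => star (x s))

theorem valueHom_apply (x : σ → F) (p : BasicTerm d σ) :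
    valueHom α x p = BasicTerm.value α p x := rfl

theorem valueHom_X_inl (x : σ → F) (s : σ) : valueHom α x (MvPolynomial.X (Sum.inl s)) = x s := by
  simp [valueHom]

/-- Swapping each variable with its star conjugates the value, because the coefficients take
self-adjoint values. -/
theorem exists_star_term (hα : ∀ i, star (α i) = α i) (p : BasicTerm d σ) :
    ∃ q, ∀ x : σ → F, valueHom α x q = star (valueHom α x p) := by
  refine ⟨MvPolynomial.rename Sum.swap p, fun x => ?_⟩
  have : (valueHom α x).comp (MvPolynomial.rename (R := MvPolynomial (Fin d) ℤ)
      (Sum.swap : σ ⊕ σ → σ ⊕ σ)).toRingHom = (starRingEnd F).comp (valueHom α x) := by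
    refine MvPolynomial.ringHom_ext (fun a => ?_) fun s => ?_
    · have h : MvPolynomial.eval₂Hom (Int.castRingHom F) α =
          (starRingEnd F).comp (MvPolynomial.eval₂Hom (Int.castRingHom F) α) :=
        MvPolynomial.ringHom_ext (fun a => by simp) fun i => by simp [hα, starRingEnd_apply]
      have h' := congrArg (fun f => f a) h
      simpa [valueHom] using h'
    · cases s <;> simp [valueHom, starRingEnd_apply]
  exact congrArg (fun f => f p) this

theorem exists_const_term (i : Fin d) :
    ∃ c : BasicTerm d σ, ∀ x : σ → F, valueHom α x c = α i :=
  ⟨MvPolynomial.C (MvPolynomial.X i), fun x => by simp [valueHom]⟩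

end BasicTerms

/-! ### Scaling to pivot 1 and clearing denominators. -/

section Normalization

variable {F : Type*} [Field F] {d n : ℕ} {dims : Fin n → ℕ}

/-- A coordinate tuple as an assignment of the variables. -/
def assign (r : Coords F d dims) : CoordVar d dims → F := fun s => r s.1 s.2

/-- The coordinate tuple with the pivot coordinates `J` scaled to one. -/
def normalize (J : (k : Fin n) → Idx d (dims k)) (r : Coords F d dims) : Coords F d dims :=
  fun k I => r k I / pivot (J k) (r k)

theorem map_pivot {R S : Type*} [CommRing R] [CommRing S] {k : ℕ} (φ : R →+* S) (J : Idx d k)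
    (y : Idx d k → R) : φ (pivot J y) = pivot J fun I => φ (y I) := by
  unfold pivot
  split_ifs
  · exact φ.map_one
  · rfl

theorem pivot_smul_eq_zero {k : ℕ} (J : Idx d k) (y : Idx d k → F) {c : F} (hc : c ≠ 0) :
    pivot J (c • y) = 0 ↔ pivot J y = 0 := by
  unfold pivot
  split_ifs <;> simp [hc]

/-- Where `dims k = 0` the pivot is the constant 1 and does not scale; there the Grassmannian
hypothesis forces `r k = 0`. -/
theorem normalize_smul (J : (k : Fin n) → Idx d (dims k)) {r : Coords F d dims}
    (hr : r ∈ grassmannProd F d dims) {c : Fin n → F} (hc : ∀ k, c k ≠ 0) :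
    normalize J (fun k => c k • r k) = normalize J r := by
  ext k I
  by_cases hk : dims k = 0
  · have : r k = 0 := eq_zero_of_mem_grassmann (hr k) hk
    simp [normalize, this]
  · simp only [normalize, pivot, if_neg hk, Pi.smul_apply, smul_eq_mul]
    exact mul_div_mul_left _ _ (hc k)

theorem mem_pluckerSet_iff {α : Fin d → F} {M : Set (Fin n → SubspaceLattice α)} {r : Coords F d dims} :
    r ∈ pluckerSet M dims ↔ ∃ J : (k : Fin n) → Idx d (dims k),
      (∀ k, pivot (J k) (r k) ≠ 0) ∧ (∀ k I, pluckerDefect (J k) (normalize J r k) I = 0) ∧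
        (fun k => SubspaceLattice.of α
          (LinearMap.range (pluckerMatrix (J k) (normalize J r k)).mulVecLin)) ∈ M := by
  constructor
  · rintro ⟨u, hu, h⟩
    choose J hpiv hdef hrange using fun k => mem_plucker_iff.1 (h k)
    refine ⟨J, hpiv, hdef, ?_⟩
    convert hu using 1
    exact funext hrange
  · rintro ⟨J, hpiv, hdef, hM⟩
    exact ⟨_, hM, fun k => mem_plucker_iff.2 ⟨J k, hpiv k, hdef k, rfl⟩⟩

variable [StarRing F] {α : Fin d → F}

/-- Basic terms at normalized points can be rewritten as basic terms by clearing denominators. -/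
theorem exists_cleared_term (hα : ∀ i, star (α i) = α i) (J : (k : Fin n) → Idx d (dims k))
    (p : BasicTerm d (CoordVar d dims)) : ∃ q : BasicTerm d (CoordVar d dims),
      ∀ r : Coords F d dims, valueHom α (assign r) q = 0 ↔
        (∃ k, pivot (J k) (r k) = 0) ∨ valueHom α (assign (normalize J r)) p = 0 := by
  classical
  choose st hst using exists_star_term (σ := CoordVar d dims) hα
  let P (k : Fin n) : BasicTerm d (CoordVar d dims) :=
    pivot (J k) fun I => MvPolynomial.X (Sum.inl ⟨k, I⟩)
  have hP : ∀ k (r : Coords F d dims), valueHom α (assign r) (P k) = pivot (J k) (r k) :=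
    fun k r => by
      rw [map_pivot]
      congr 1
      ext I
      exact valueHom_X_inl _ _
  -- Each variable or starred variable at the normalized point has a pivot or its conjugate as
  -- denominator, so powers of `D` clear all denominators.
  let D : BasicTerm d (CoordVar d dims) := ∏ k, P k * st (P k)
  have hD : ∀ r : Coords F d dims, valueHom α (assign r) D = 0 ↔ ∃ k, pivot (J k) (r k) = 0 :=
    fun r => by
      simp [D, map_prod, Finset.prod_eq_zero_iff, hst, hP]
  have hdvd : ∀ k, ∃ Q : BasicTerm d (CoordVar d dims), D = P k * st (P k) * Q := fun k =>
    Finset.dvd_prod_of_mem _ (Finset.mem_univ k)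
  have key : ∃ (q : BasicTerm d (CoordVar d dims)) (N : ℕ), ∀ r : Coords F d dims,
      valueHom α (assign r) D ≠ 0 → valueHom α (assign r) q =
        valueHom α (assign r) D ^ N * valueHom α (assign (normalize J r)) p := by
    induction p using MvPolynomial.induction_on with
    | C a => exact ⟨MvPolynomial.C a, 0, fun r _ => by simp [valueHom]⟩
    | add p₁ p₂ h₁ h₂ =>
      obtain ⟨q₁, N₁, h₁⟩ := h₁
      obtain ⟨q₂, N₂, h₂⟩ := h₂
      refine ⟨D ^ N₂ * q₁ + D ^ N₁ * q₂, N₁ + N₂, fun r hr => ?_⟩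
      rw [map_add, map_add, map_mul, map_mul, map_pow, map_pow, h₁ r hr, h₂ r hr]
      ring
    | mul_X p s h =>
      obtain ⟨q, N, h⟩ := h
      have hX : ∃ q' : BasicTerm d (CoordVar d dims), ∀ r : Coords F d dims,
          valueHom α (assign r) D ≠ 0 → valueHom α (assign r) q' = valueHom α (assign r) D *
            valueHom α (assign (normalize J r)) (MvPolynomial.X s) := by
        rcases s with ⟨k, I⟩ | ⟨k, I⟩
        · obtain ⟨Q, hQ⟩ := hdvd k
          refine ⟨st (P k) * Q * MvPolynomial.X (Sum.inl ⟨k, I⟩), fun r hr => ?_⟩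
          have hk : pivot (J k) (r k) ≠ 0 := fun h0 => hr ((hD r).2 ⟨k, h0⟩)
          rw [hQ]
          simp only [map_mul, hst, hP, valueHom_X_inl, assign, normalize]
          field_simp
        · obtain ⟨Q, hQ⟩ := hdvd k
          refine ⟨P k * Q * MvPolynomial.X (Sum.inr ⟨k, I⟩), fun r hr => ?_⟩
          have hk : pivot (J k) (r k) ≠ 0 := fun h0 => hr ((hD r).2 ⟨k, h0⟩)
          have hk' : star (pivot (J k) (r k)) ≠ 0 := star_ne_zero.2 hk
          have hinr : ∀ x : CoordVar d dims → F,
              valueHom α x (MvPolynomial.X (Sum.inr ⟨k, I⟩)) = star (x ⟨k, I⟩) := fun x => by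
            simp [valueHom]
          rw [hQ]
          simp only [map_mul, hst, hP, hinr, assign, normalize, star_div₀]
          field_simp
      obtain ⟨q', hq'⟩ := hX
      refine ⟨q * q', N + 1, fun r hr => ?_⟩
      rw [map_mul, map_mul, h r hr, hq' r hr]
      ring
  obtain ⟨q, N, hq⟩ := key
  -- The extra factor `D` forces vanishing wherever a pivot is zero, where normalization is
  -- meaningless and `q` is uncontrolled.
  refine ⟨D * q, fun r => ?_⟩
  rw [map_mul, mul_eq_zero, hD]
  by_cases h : ∃ k, pivot (J k) (r k) = 0
  · simp [h]
  · have hr : valueHom α (assign r) D ≠ 0 := fun h0 => h ((hD r).1 h0)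
    simp [h, hq r hr, hr]

/-- Whether a basic term vanishes does not depend on the scaling of the coordinates. -/
def VanishingInvariant (α : Fin d → F) (q : BasicTerm d (CoordVar d dims)) : Prop :=
  ∀ r ∈ grassmannProd F d dims, ∀ c : Fin n → F, (∀ k, c k ≠ 0) →
    (valueHom α (assign r) q = 0 ↔ valueHom α (assign fun k => c k • r k) q = 0)

theorem exists_invariant_terms (hα : ∀ i, star (α i) = α i) (J : (k : Fin n) → Idx d (dims k))
    {P : Coords F d dims → Prop}
    (hP : Determined (fun r : Coords F d dims => valueHom α (assign (normalize J r))) P) :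
    ∃ L : Finset (BasicTerm d (CoordVar d dims)), (∀ q ∈ L, VanishingInvariant α q) ∧
      ∀ r r', SameZeros (fun r : Coords F d dims => valueHom α (assign r)) L r r' →
        (∀ k, pivot (J k) (r k) ≠ 0) ∧ P r → (∀ k, pivot (J k) (r' k) ≠ 0) ∧ P r' := by
  classical
  obtain ⟨L, hL⟩ := hP
  choose q hq using exists_cleared_term (F := F) (dims := dims) hα J
  -- The cleared term of `1` vanishes exactly when some pivot does, so the pattern also records that
  -- all pivots are nonzero.
  refine ⟨(insert 1 L).image q, ?_, fun r r' h ⟨hpiv, hPr⟩ => ?_⟩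
  · intro _ hp r hr c hc
    obtain ⟨p, -, rfl⟩ := Finset.mem_image.1 hp
    simp only [hq, normalize_smul J hr hc, pivot_smul_eq_zero _ _ (hc _)]
  · have h' : ∀ p ∈ insert 1 L, valueHom α (assign r) (q p) = 0 ↔ valueHom α (assign r') (q p) = 0 :=
      fun p hp => h _ (Finset.mem_image_of_mem q hp)
    have hr : ¬ ∃ k, pivot (J k) (r k) = 0 := fun ⟨k, hk⟩ => hpiv k hk
    have hr' : ¬ ∃ k, pivot (J k) (r' k) = 0 := by
      have := h' 1 (Finset.mem_insert_self _ _)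
      simp only [hq, map_one, one_ne_zero, or_false] at this
      exact fun h0 => hr (this.2 h0)
    refine ⟨fun k hk => hr' ⟨k, hk⟩, hL r r' (fun p hp => ?_) hPr⟩
    have := h' p (Finset.mem_insert_of_mem hp)
    simpa only [hq, hr, hr', false_or] using this

end Normalization

/-! ### From zero patterns to disjoint basic formulas. -/

section BasicFormulas

variable {F : Type*} [Field F] [StarRing F] {d n : ℕ} {dims : Fin n → ℕ} {α : Fin d → F}

/-- The basic formula stating that exactly the members of `T` among those of `L` vanish. -/
noncomputable def zeroPattern (L T : Finset (BasicTerm d (CoordVar d dims))) :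
    BasicFormula d (CoordVar d dims) :=
  ⟨T.toList, by classical exact (L \ T).toList⟩

theorem mem_definedSet_zeroPattern {L T : Finset (BasicTerm d (CoordVar d dims))} (hT : T ⊆ L)
    (r : Coords F d dims) : r ∈ (zeroPattern L T).definedSet α ↔
      ∀ p ∈ L, valueHom α (assign r) p = 0 ↔ p ∈ T := by
  classical
  have : r ∈ (zeroPattern L T).definedSet α ↔
      (∀ p ∈ T, valueHom α (assign r) p = 0) ∧ ∀ p ∈ L \ T, valueHom α (assign r) p ≠ 0 := by
    simp only [BasicFormula.definedSet, BasicFormula.Holds, zeroPattern, Finset.mem_toList,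
      ← valueHom_apply]
    rfl
  rw [this]
  constructor
  · rintro ⟨h₁, h₂⟩ p hp
    exact ⟨fun h => by_contra fun hpT => h₂ p (Finset.mem_sdiff.2 ⟨hp, hpT⟩) h, h₁ p⟩
  · intro h
    refine ⟨fun p hp => (h p (hT hp)).2 hp, fun p hp h0 => ?_⟩
    rw [Finset.mem_sdiff] at hp
    exact hp.2 ((h p hp.1).1 h0)

theorem exists_disjoint_basicFormulas (L : Finset (BasicTerm d (CoordVar d dims)))
    (hL : ∀ q ∈ L, VanishingInvariant α q) (Δ : Set (Coords F d dims))
    (hΔ : ∀ r r', SameZeros (fun r : Coords F d dims => valueHom α (assign r)) L r r' →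
      r ∈ Δ → r' ∈ Δ) :
    ∃ (N : ℕ) (χ : Fin N → BasicFormula d (CoordVar d dims)),
      (∀ i, (χ i).IsScalarInvariant α) ∧
      Pairwise (fun i j => Disjoint ((χ i).definedSet α) ((χ j).definedSet α)) ∧
      Δ = ⋃ i, (χ i).definedSet α := by
  classical
  -- Only patterns occurring at a point of `Δ` are kept; each cuts out one full class of
  -- `SameZeros`, and `Δ` is a union of classes.
  let 𝒯 : Finset (Finset (BasicTerm d (CoordVar d dims))) :=
    L.powerset.filter fun T => ∃ r ∈ Δ, r ∈ (zeroPattern L T).definedSet α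
  have hsub : ∀ T : 𝒯, T.1 ⊆ L := fun T =>
    Finset.mem_powerset.1 (Finset.mem_filter.1 T.2).1
  let e : 𝒯 ≃ Fin (Fintype.card 𝒯) := Fintype.equivFin 𝒯
  refine ⟨Fintype.card 𝒯, fun i => zeroPattern L (e.symm i).1, fun i r hr c hc => ?_,
    fun i j hij => ?_, ?_⟩
  · rw [mem_definedSet_zeroPattern (hsub _), mem_definedSet_zeroPattern (hsub _)]
    exact forall₂_congr fun p hp => by rw [hL p hp r hr c hc]
  · dsimp only
    rw [Set.disjoint_left]
    intro r hi hj
    rw [mem_definedSet_zeroPattern (hsub _)] at hi hj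
    refine hij (e.symm.injective (Subtype.ext (Finset.ext fun p => ?_)))
    constructor
    · exact fun hp => (hj p (hsub _ hp)).1 ((hi p (hsub _ hp)).2 hp)
    · exact fun hp => (hi p (hsub _ hp)).1 ((hj p (hsub _ hp)).2 hp)
  · ext r
    rw [Set.mem_iUnion]
    constructor
    · intro hr
      let T := L.filter fun p => valueHom α (assign r) p = 0
      have hTL : T ⊆ L := Finset.filter_subset _ _
      have hrT : r ∈ (zeroPattern L T).definedSet α := by
        rw [mem_definedSet_zeroPattern hTL]
        exact fun p hp => by simp [T, hp]
      refine ⟨e ⟨T, Finset.mem_filter.2 ⟨Finset.mem_powerset.2 hTL, r, hr, hrT⟩⟩, ?_⟩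
      dsimp only
      rwa [e.symm_apply_apply]
    · rintro ⟨i, hi⟩
      obtain ⟨r₀, hr₀, h₀⟩ := (Finset.mem_filter.1 (e.symm i).2).2
      rw [mem_definedSet_zeroPattern (hsub _)] at hi h₀
      exact hΔ r₀ r (fun p hp => (h₀ p hp).trans (hi p hp).symm) hr₀

/-- The defects and reconstructed matrices are evaluations of those of the generic vector of
variables `y`, so the results on parametrized families apply. -/
theorem determined_normalized (hα : ∀ i, star (α i) = α i) {φ : latLang.Formula (Fin n)}
    (hφ : φ.IsQF) (J : (k : Fin n) → Idx d (dims k)) :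
    Determined (fun r : Coords F d dims => valueHom α (assign (normalize J r))) fun r =>
      (∀ k I, pluckerDefect (J k) (normalize J r k) I = 0) ∧
        φ.Realize fun k => SubspaceLattice.of α
          (LinearMap.range (pluckerMatrix (J k) (normalize J r k)).mulVecLin) := by
  let y (k : Fin n) (I : Idx d (dims k)) : BasicTerm d (CoordVar d dims) :=
    MvPolynomial.X (Sum.inl ⟨k, I⟩)
  have hy : ∀ (r : Coords F d dims) k, (fun I => valueHom α (assign (normalize J r)) (y k I)) =
      normalize J r k := fun r k => by
    ext I
    exact valueHom_X_inl _ _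
  refine .and (.forall fun k => .forall fun I => ?_) (.qf_realize hα ?_ ?_ _ (fun k => ?_) hφ)
  · have := Determined.eq_zero (ev := fun r : Coords F d dims => valueHom α (assign (normalize J r)))
      (pluckerDefect (J k) (y k) I)
    simpa only [map_pluckerDefect, hy] using this
  · intro p
    obtain ⟨q, hq⟩ := exists_star_term (F := F) hα p
    exact ⟨q, fun r => hq _⟩
  · intro i
    obtain ⟨c, hc⟩ := exists_const_term (α := α) (σ := CoordVar d dims) i
    exact ⟨c, fun r => hc _⟩
  · have := Parametrized.of_matrix
      (ev := fun r : Coords F d dims => valueHom α (assign (normalize J r)))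
      (pluckerMatrix (J k) (y k))
    simp only [pluckerMatrix_map, hy] at this
    exact this

end BasicFormulas

end PluckerQF

theorem corollary15 {F : Type*} [Field F] [StarRing F] {d n : ℕ} (α : Fin d → F)
    (hα : ∀ i, star (α i) = α i ∧ α i ≠ 0)
    (M : Set (Fin n → PluckerQF.SubspaceLattice α)) (hM : PluckerQF.IsQFDefinable α M)
    (dims : Fin n → ℕ) (hdims : ∀ k, dims k ≤ d) :
    PluckerQF.pluckerSet M dims ⊆ PluckerQF.grassmannProd F d dims ∧
    PluckerQF.ScalarInvariant (PluckerQF.pluckerSet M dims) ∧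
    ∃ (N : ℕ) (χ : Fin N → PluckerQF.BasicFormula d (PluckerQF.CoordVar d dims)),
      (∀ i, (χ i).IsScalarInvariant α) ∧
      Pairwise (fun i j => Disjoint ((χ i).definedSet α) ((χ j).definedSet α)) ∧
      PluckerQF.pluckerSet M dims = ⋃ i, (χ i).definedSet α := by
  classical
  refine ⟨?_, ?_, ?_⟩
  · rintro r ⟨u, -, hu⟩ k
    exact PluckerQF.plucker_subset_grassmann (hu k).1 (hu k).2
  · rintro r ⟨u, huM, hu⟩ c hc
    exact ⟨u, huM, fun k => ⟨(hu k).1, PluckerQF.smul_mem_plucker (hu k).2 (hc k)⟩⟩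
  · obtain ⟨φ, hφ, rfl⟩ := hM
    have hα' := fun i => (hα i).1
    choose L hLinv hL using fun J : (k : Fin n) → PluckerQF.Idx d (dims k) =>
      PluckerQF.exists_invariant_terms hα' J (PluckerQF.determined_normalized hα' hφ J)
    -- Taking the terms for all `J` at once makes membership in `Δ` transfer with the same `J`, and
    -- the patterns stay disjoint although pivot charts overlap.
    refine PluckerQF.exists_disjoint_basicFormulas (Finset.univ.biUnion L) ?_ _ ?_
    · intro q hq
      obtain ⟨J, -, hJ⟩ := Finset.mem_biUnion.1 hq
      exact hLinv J q hJ
    · intro r r' h hr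
      obtain ⟨J, hJ⟩ := PluckerQF.mem_pluckerSet_iff.1 hr
      exact PluckerQF.mem_pluckerSet_iff.2 ⟨J, hL J r r'
        (h.mono (Finset.subset_biUnion_of_mem L (Finset.mem_univ J))) hJ⟩
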